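/- All graphs are finite, undirected and simple. A path decomposition of a graph $G$ is a collection of pairwise edge-disjoint paths of $G$ that covers all the edges of $G$; $p(G)$ denotes the minimum number of paths in a path decomposition of $G$, and $n_o(G)$ the number of vertices of odd degree in $G$. The Cartesian product $G\Box H$ is the graph on $V(G)\times V(H)$ in which $(u_1,v_1)$ and $(u_2,v_2)$ are adjacent if and only if either $u_1u_2\in E(G)$ and $v_1=v_2$, or $v_1v_2\in E(H)$ and $u_1=u_2$. Theorem 4.2. Let $G$ be a connected graph of order $m\ge 2$ and let $H$ be a connected graph of order $n$. If $p(G)=\frac{n_o(G)}{2}$, then $p(G\Box H)\le \frac{mn}{2}$. In particular, $G\Box H$ is a connected graph of order $mn$ with $p(G\Box H)\le\lceil\frac{mn}{2}\rceil$, that is, Gallai's conjecture (every connected graph of order $N$ can be decomposed into at most $\lceil\frac{N}{2}\rceil$ paths) holds for $G\Box H$. -/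

import Mathlib

namespace SimpleGraph

variable {V : Type*}

/-- A subgraph `S` of `G` is a path if it consists of the vertices and edges of a walk in `G`
that repeats no vertex. (One-vertex paths are allowed; they never affect the minimum number of
paths in a path decomposition.) -/
def Subgraph.IsPathSubgraph {G : SimpleGraph V} (S : G.Subgraph) : Prop :=
  ∃ (u v : V) (w : G.Walk u v), w.IsPath ∧ w.toSubgraph = S

/-- A path decomposition of `G`: a finite collection of pairwise edge-disjoint paths of `G` that
covers all the edges of `G`. -/
structure IsPathDecomposition (G : SimpleGraph V) (P : Finset G.Subgraph) : Prop where
  isPath : ∀ S ∈ P, S.IsPathSubgraph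
  edgeDisjoint : ∀ S ∈ P, ∀ T ∈ P, S ≠ T → Disjoint S.edgeSet T.edgeSet
  cover : ∀ e ∈ G.edgeSet, ∃ S ∈ P, e ∈ S.edgeSet

/-- `p(G)`, the minimum number of paths in a path decomposition of `G`. For finite `G` the
minimum is attained, see `exists_isPathDecomposition_card_eq_pathNumber`. -/
noncomputable def pathNumber (G : SimpleGraph V) : ℕ :=
  sInf {k : ℕ | ∃ P : Finset G.Subgraph, G.IsPathDecomposition P ∧ P.card = k}

/-- `n_o(G)`, the number of vertices of odd degree in `G`. -/
def oddVertexCount (G : SimpleGraph V) [Fintype V] [DecidableRel G.Adj] : ℕ :=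
  (Finset.univ.filter fun v : V => Odd (G.degree v)).card

/-- A finite graph has a path decomposition: its single edges. -/
theorem exists_isPathDecomposition [Finite V] (G : SimpleGraph V) :
    ∃ P : Finset G.Subgraph, G.IsPathDecomposition P := by
  classical
  have hfin : {S : G.Subgraph | ∃ (u v : V) (h : G.Adj u v), G.subgraphOfAdj h = S}.Finite :=
    Set.toFinite _
  refine ⟨hfin.toFinset, ?_, ?_, ?_⟩
  · intro S hS
    obtain ⟨u, v, h, rfl⟩ := hfin.mem_toFinset.1 hS
    exact ⟨u, v, Walk.cons h Walk.nil, by simp [h.ne],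
      Walk.toSubgraph_cons_nil_eq_subgraphOfAdj h⟩
  · intro S hS T hT hne
    obtain ⟨u, v, h, rfl⟩ := hfin.mem_toFinset.1 hS
    obtain ⟨a, b, h', rfl⟩ := hfin.mem_toFinset.1 hT
    rw [Set.disjoint_left]
    intro e he he'
    rw [edgeSet_subgraphOfAdj, Set.mem_singleton_iff] at he he'
    apply hne
    have hs : s(u, v) = s(a, b) := he.symm.trans he'
    rcases Sym2.eq_iff.1 hs with ⟨rfl, rfl⟩ | ⟨rfl, rfl⟩
    · rfl
    · exact (subgraphOfAdj_symm h').symm ▸ rfl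
  · intro e he
    induction e with
    | _ u v =>
      have h : G.Adj u v := he
      exact ⟨G.subgraphOfAdj h, hfin.mem_toFinset.2 ⟨u, v, h, rfl⟩, by simp⟩

/-- The minimum defining `pathNumber` is attained for finite graphs. -/
theorem exists_isPathDecomposition_card_eq_pathNumber [Finite V] (G : SimpleGraph V) :
    ∃ P : Finset G.Subgraph, G.IsPathDecomposition P ∧ P.card = G.pathNumber := by
  obtain ⟨P, hP⟩ := G.exists_isPathDecomposition
  exact Nat.sInf_mem (s := {k : ℕ | ∃ P : Finset G.Subgraph,
    G.IsPathDecomposition P ∧ P.card = k}) ⟨P.card, P, hP, rfl⟩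

end SimpleGraph

/-! Write `O` and `Z` for the sets of odd and even vertices of `G`. Every odd vertex is an end in
any path decomposition, so `p(G) = |O|/2` forces a decomposition in which each odd vertex is an end
exactly once and no even vertex is an end (`exists_isSystem_odd`). Use it in all `n` copies of `G`,
and absorb most of the copies of `H` by attaching their paths to these ends.

Over an odd vertex, `H` is decomposed into paths with one rooted at each of its vertices `w`
(`exists_rooted_paths`); the path rooted at `w` extends the path of the `w`-th copy of `G` that ends
there. Over an even vertex, `H` is decomposed into pairs of paths rooted at the vertices of a set
`S`, together with a family `F`, where `|S| + |F| ≤ n/2` (`exists_rooted_pairs`). For `w ∈ S` the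
paths of the `w`-th copy of `G` are cut at all even vertices (`IsSystem.exists_cut`), which creates
two ends at each for the pair rooted at `w`. The total is `n|O|/2 + |Z|(|S| + |F|) ≤ mn/2`.

Both decompositions of `H` come from `exists_two_isSystem`. Paths joining two even vertices of one
component are removed while possible; their ends become odd and stay odd. The rest has at most one
even vertex per component and so decomposes into paths with every odd vertex an end exactly once.
This is a Lovász-type theorem (`exists_isSystem`), proved by restoring edges one at a time
(`IsSystem.add_edge`). Hall's theorem then selects the roots and the pairs. -/

namespace SimpleGraph.PathSystem

open Multiset

variable {V W : Type*}

/-! ### Paths as vertex lists: edges and ends. -/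

/-- The first vertex of a list, as a multiset (empty for the empty list). -/
def first : List V → Multiset V
  | [] => 0
  | a :: _ => {a}

/-- The edges joining consecutive vertices of a list. -/
def pathEdges : List V → Multiset (Sym2 V)
  | [] => 0
  | a :: l => (first l).map (fun c => s(a, c)) + pathEdges l

/-- The two ends of a list; a one-vertex list has twice the same end. -/
def pathEnds (l : List V) : Multiset V := first l + first l.reverse

@[simp] theorem first_nil : first ([] : List V) = 0 := rfl

@[simp] theorem first_cons (a : V) (l : List V) : first (a :: l) = {a} := rfl

@[simp] theorem pathEdges_nil : pathEdges ([] : List V) = 0 := rfl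

theorem pathEdges_cons (a : V) (l : List V) :
    pathEdges (a :: l) = (first l).map (fun c => s(a, c)) + pathEdges l := rfl

@[simp] theorem pathEdges_singleton (a : V) : pathEdges [a] = 0 := by simp [pathEdges_cons]

theorem first_append_of_ne_nil {l : List V} (h : l ≠ []) (l' : List V) :
    first (l ++ l') = first l := by
  cases l with
  | nil => exact absurd rfl h
  | cons a l => rfl

theorem first_append_cons (l : List V) (a : V) (l' : List V) :
    first (l ++ a :: l') = first (l ++ [a]) := by
  cases l <;> rfl

theorem first_reverse_append_cons (l : List V) (a : V) (l' : List V) :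
    first (l ++ a :: l').reverse = first (a :: l').reverse := by
  rw [List.reverse_append]
  exact first_append_of_ne_nil (by simp) _

theorem pathEdges_append_cons (l : List V) (a : V) (l' : List V) :
    pathEdges (l ++ a :: l') = pathEdges (l ++ [a]) + pathEdges (a :: l') := by
  induction l with
  | nil => simp
  | cons c l ih =>
    rw [List.cons_append, List.cons_append, pathEdges_cons, pathEdges_cons c (l ++ [a]), ih,
      first_append_cons, add_assoc]

theorem pathEdges_concat (l : List V) (a : V) :
    pathEdges (l ++ [a]) = pathEdges l + (first l.reverse).map (fun c => s(c, a)) := by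
  rcases List.eq_nil_or_concat l with rfl | ⟨l', c, rfl⟩
  · simp
  · rw [List.concat_eq_append, List.append_assoc, List.singleton_append, pathEdges_append_cons]
    simp [pathEdges_cons]

@[simp] theorem pathEdges_reverse (l : List V) : pathEdges l.reverse = pathEdges l := by
  induction l with
  | nil => rfl
  | cons a l ih =>
    rw [List.reverse_cons, pathEdges_concat, ih, List.reverse_reverse, pathEdges_cons, add_comm]
    simp only [Sym2.eq_swap]

theorem pathEdges_map (f : V → W) (l : List V) :
    pathEdges (l.map f) = (pathEdges l).map (Sym2.map f) := by
  induction l with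
  | nil => rfl
  | cons a l ih =>
    rw [List.map_cons, pathEdges_cons, pathEdges_cons, ih, Multiset.map_add]
    cases l <;> simp

@[simp] theorem pathEnds_reverse (l : List V) : pathEnds l.reverse = pathEnds l := by
  simp [pathEnds, add_comm]

theorem card_first {l : List V} (h : l ≠ []) : card (first l) = 1 := by
  cases l with
  | nil => exact absurd rfl h
  | cons a l => rfl

theorem card_pathEnds {l : List V} (h : l ≠ []) : card (pathEnds l) = 2 := by
  rw [pathEnds, card_add, card_first h, card_first (by simpa using h)]

theorem mem_of_mem_first {l : List V} {a : V} (h : a ∈ first l) : a ∈ l := by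
  cases l with
  | nil => simp at h
  | cons c l => simp_all

theorem mem_of_mem_pathEnds {l : List V} {a : V} (h : a ∈ pathEnds l) : a ∈ l := by
  rcases Multiset.mem_add.1 h with h | h
  · exact mem_of_mem_first h
  · simpa using mem_of_mem_first h

theorem exists_cons_of_mem_first {l : List V} {a : V} (h : a ∈ first l) : ∃ t, l = a :: t := by
  cases l with
  | nil => simp at h
  | cons c l => exact ⟨l, by simp_all⟩

/-- The end of the list `b :: l` other than `b`, except that it is `b` if `l` is empty. -/
def farEnd (b : V) (l : List V) : Multiset V := first (b :: l).reverse

/-- Reversal swaps the two ends of a nonempty arm and fixes the empty one. This balances the ends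
when arms are reversed in `IsSystem.add_edge`. -/
theorem farEnd_add_first_reverse (b : V) (l : List V) :
    farEnd b l.reverse + first l.reverse = farEnd b l + first l := by
  cases l with
  | nil => rfl
  | cons a l =>
    have h1 : farEnd b (a :: l) = first (a :: l).reverse := by
      rw [farEnd, List.reverse_cons]
      exact first_append_of_ne_nil (by simp) _
    have h2 : farEnd b (a :: l).reverse = first (a :: l) := by
      rw [farEnd, List.reverse_cons, List.reverse_reverse]
      rfl
    rw [h1, h2, add_comm]

theorem pathEnds_through (A B : List V) (b : V) :
    pathEnds (A.reverse ++ b :: B) = farEnd b A + farEnd b B := by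
  rw [pathEnds, first_append_cons, first_reverse_append_cons, farEnd, farEnd,
    @List.reverse_cons _ b A]

theorem pathEdges_through (A B : List V) (b : V) :
    pathEdges (A.reverse ++ b :: B) = pathEdges (b :: A) + pathEdges (b :: B) := by
  rw [pathEdges_append_cons, ← List.reverse_cons, pathEdges_reverse]

/-! ### Path systems. -/

/-- A multiset of lists without repeated vertices, with prescribed multisets of edges
and of ends. -/
structure IsSystem (M : Multiset (List V)) (E : Multiset (Sym2 V)) (D : Multiset V) : Prop where
  ne_nil : ∀ l ∈ M, l ≠ []
  nodup : ∀ l ∈ M, l.Nodup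
  edges : (M.map pathEdges).sum = E
  ends : (M.map pathEnds).sum = D

theorem IsSystem.card_ends {M : Multiset (List V)} {E : Multiset (Sym2 V)} {D : Multiset V}
    (h : IsSystem M E D) : card D = 2 * card M := by
  rw [← h.ends]
  have := h.ne_nil
  clear h
  induction M using Multiset.induction_on with
  | empty => rfl
  | cons l M ih =>
    rw [Multiset.map_cons, sum_cons, card_add, card_cons, ih fun l' hl => this l' (by simp [hl]),
      card_pathEnds (this l (by simp))]
    ring

theorem IsSystem.add {M M' : Multiset (List V)} {E E' : Multiset (Sym2 V)} {D D' : Multiset V}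
    (h : IsSystem M E D) (h' : IsSystem M' E' D') : IsSystem (M + M') (E + E') (D + D') where
  ne_nil l hl := (Multiset.mem_add.1 hl).elim (h.ne_nil l) (h'.ne_nil l)
  nodup l hl := (Multiset.mem_add.1 hl).elim (h.nodup l) (h'.nodup l)
  edges := by rw [Multiset.map_add, sum_add, h.edges, h'.edges]
  ends := by rw [Multiset.map_add, sum_add, h.ends, h'.ends]

theorem isSystem_singleton {l : List V} (h : l ≠ []) (h' : l.Nodup) :
    IsSystem {l} (pathEdges l) (pathEnds l) where
  ne_nil := by simpa using h
  nodup := by simpa using h'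
  edges := by simp
  ends := by simp

/-! ### Restoring an edge by reversing arms. -/

/-- Arms can be reversed, and one further path attached, so that the multiset of attached vertices
grows exactly by the given vertex `x`. -/
theorem exists_reversed_arms {ι : Type*} [DecidableEq ι] (arm : ι → List V)
    (R : Multiset (List V)) (s : Finset ι) (x : V)
    (hnd : (x ::ₘ ∑ i ∈ s, first (arm i)).Nodup)
    (hend : ∀ u ∈ x ::ₘ ∑ i ∈ s, first (arm i),
      (∃ r ∈ R, u ∈ pathEnds r) ∨ ∃ i ∈ s, u ∈ first (arm i).reverse) :
    ∃ arm' : ι → List V, (∀ i, arm' i = arm i ∨ arm' i = (arm i).reverse) ∧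
      ∃ r ∈ R, ∃ r', (r' = r ∨ r' = r.reverse) ∧
        ∑ i ∈ s, first (arm' i) + first r' = ∑ i ∈ s, first (arm i) + {x} := by
  induction hn : s.card generalizing s x with
  | zero =>
    obtain rfl := Finset.card_eq_zero.1 hn
    obtain ⟨r, hr, hx⟩ | ⟨i, hi, -⟩ := hend x (by simp)
    · refine ⟨arm, fun i => Or.inl rfl, r, hr, ?_⟩
      rcases Multiset.mem_add.1 hx with h | h
      · obtain ⟨t, rfl⟩ := exists_cons_of_mem_first h
        exact ⟨_, Or.inl rfl, by simp⟩
      · obtain ⟨t, ht⟩ := exists_cons_of_mem_first h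
        exact ⟨_, Or.inr rfl, by simp [ht]⟩
    · simp at hi
  | succ n ih =>
    obtain ⟨r, hr, hx⟩ | ⟨i, hi, hx⟩ := hend x (by simp)
    · refine ⟨arm, fun i => Or.inl rfl, r, hr, ?_⟩
      rcases Multiset.mem_add.1 hx with h | h
      · obtain ⟨t, rfl⟩ := exists_cons_of_mem_first h
        exact ⟨_, Or.inl rfl, by simp⟩
      · obtain ⟨t, ht⟩ := exists_cons_of_mem_first h
        exact ⟨_, Or.inr rfl, by simp [ht]⟩
    -- Here `x` is the far end of arm `i`. Reversing this arm attaches `x` but loses its former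
    -- first vertex `y`, so the same problem recurs for `y` with arm `i` set aside.
    · have hsum := Finset.add_sum_erase s (fun i => first (arm i)) hi
      obtain ⟨t, ht⟩ := exists_cons_of_mem_first hx
      obtain ⟨y, t', hy⟩ : ∃ y t', arm i = y :: t' := by
        cases h : arm i with
        | nil => simp [h] at ht
        | cons y t' => exact ⟨y, t', rfl⟩
      rw [← hsum] at hnd hend
      simp only [hy, first_cons, Multiset.singleton_add] at hnd hend
      have hx' := (Multiset.nodup_cons.1 hnd).1
      obtain ⟨arm', harm, r, hr, r', hr', heq⟩ := ih (s.erase i) y (Multiset.nodup_cons.1 hnd).2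
        (by
          intro u hu
          refine (hend u (Multiset.mem_cons_of_mem hu)).imp_right ?_
          rintro ⟨j, hj, huj⟩
          refine ⟨j, Finset.mem_erase.2 ⟨?_, hj⟩, huj⟩
          -- Arm `i` is never needed again: its far end is `x`, which differs from `y` and from the
          -- remaining first vertices.
          rintro rfl
          simp only [ht, first_cons, Multiset.mem_singleton] at huj
          exact hx' (huj ▸ hu))
        (by rw [Finset.card_erase_of_mem hi, hn]; rfl)
      refine ⟨Function.update arm' i (arm i).reverse, ?_, r, hr, r', hr', ?_⟩
      · intro j
        by_cases hj : j = i
        · subst hj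
          simp
        · simpa [hj] using harm j
      · rw [← Finset.add_sum_erase s _ hi, ← hsum,
          Finset.sum_congr rfl (g := fun j => first (arm' j))]
        · simp only [Function.update_self, ht, first_cons]
          rw [hy, first_cons]
          rw [add_assoc, heq]
          abel
        · intro j hj
          rw [Function.update_of_ne (Finset.ne_of_mem_erase hj)]

theorem exists_eq_reverse_append_cons {l : List V} {b : V} (h : b ∈ l) :
    ∃ A B : List V, l = A.reverse ++ b :: B := by
  obtain ⟨A, B, rfl⟩ := List.append_of_mem h
  exact ⟨A.reverse, B, by simp⟩

/-- An edge `bx` can be added to a path system without changing the number of paths, provided that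
`x` and all the neighbours of `b` are ends; then `x` is an end once less and `b` once more. -/
theorem IsSystem.add_edge {M : Multiset (List V)} {E : Multiset (Sym2 V)}
    {D : Multiset V} (h : IsSystem M E D) {b x : V} (hE : (s(b, x) ::ₘ E).Nodup) (hbx : x ≠ b)
    (hD : ∀ u, s(b, u) ∈ s(b, x) ::ₘ E → u ∈ D) :
    ∃ M' D', IsSystem M' (s(b, x) ::ₘ E) D' ∧ x ::ₘ D' = b ::ₘ D := by
  classical
  -- Each path through `b` is cut at `b` into two arms, indexed by `Mb × Bool`; their first vertices
  -- are the old neighbours of `b`. The paths in `R` avoid `b`, so one of them can be prolonged to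
  -- `b`.
  set Mb := M.filter (b ∈ ·) with hMb
  set R := M.filter (b ∉ ·) with hR
  have hM : Mb + R = M := Multiset.filter_add_not _ _
  have hpart : ∀ i : Mb, ∃ A B : List V, i.1 = A.reverse ++ b :: B := fun i =>
    exists_eq_reverse_append_cons (Multiset.mem_filter.1 (Multiset.coe_mem (x := i))).2
  choose A B hAB using hpart
  let arm : Mb × Bool → List V := fun p => if p.2 then B p.1 else A p.1
  have hsum : ∀ {α : Type _} (F : List V → Multiset α) (a : Mb × Bool → List V),
      ∑ p, F (a p) = ∑ i : Mb, (F (a (i, false)) + F (a (i, true))) := by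
    intro α F a
    rw [Fintype.sum_prod_type]
    refine Finset.sum_congr rfl fun i _ => ?_
    rw [Fintype.sum_bool, add_comm]
  have hMbsum : ∀ {α : Type _} (F : List V → Multiset α),
      (Mb.map F).sum = ∑ i : Mb, F ((arm (i, false)).reverse ++ b :: arm (i, true)) := by
    intro α F
    conv_lhs => rw [← Multiset.map_univ_coe Mb, Multiset.map_map]
    refine Finset.sum_congr rfl fun i _ => ?_
    simp only [Function.comp, arm]
    rw [hAB i]
    simp
  have hedges : ∀ a : Mb × Bool → List V,
      ∑ i : Mb, pathEdges ((a (i, false)).reverse ++ b :: a (i, true)) =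
        (∑ p, first (a p)).map (fun c => s(b, c)) + ∑ p, pathEdges (a p) := by
    intro a
    have : (∑ p, first (a p)).map (fun c => s(b, c)) =
        ∑ p, (first (a p)).map (fun c => s(b, c)) :=
      map_sum (Multiset.mapAddMonoidHom fun c => s(b, c)) _ _
    rw [this, ← Finset.sum_add_distrib]
    simp only [← pathEdges_cons]
    rw [hsum (fun l => pathEdges (b :: l))]
    exact Finset.sum_congr rfl fun i _ => pathEdges_through _ _ _
  have hends : ∀ a : Mb × Bool → List V,
      ∑ i : Mb, pathEnds ((a (i, false)).reverse ++ b :: a (i, true)) =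
        ∑ p, farEnd b (a p) := by
    intro a
    rw [hsum (farEnd b)]
    exact Finset.sum_congr rfl fun i _ => pathEnds_through _ _ _
  have hEeq : (∑ p, first (arm p)).map (fun c => s(b, c)) + ∑ p, pathEdges (arm p) +
      (R.map pathEdges).sum = E := by
    rw [← hedges, ← hMbsum, ← h.edges, ← hM, Multiset.map_add, sum_add]
  have hDeq : ∑ p, farEnd b (arm p) + (R.map pathEnds).sum = D := by
    rw [← hends, ← hMbsum, ← h.ends, ← hM, Multiset.map_add, sum_add]
  have hnd : (x ::ₘ ∑ p, first (arm p)).Nodup := by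
    refine Multiset.Nodup.of_map (fun c => s(b, c)) ?_
    refine Multiset.nodup_of_le ?_ hE
    rw [Multiset.map_cons, Multiset.cons_le_cons_iff, ← hEeq, add_assoc]
    exact Multiset.le_add_right _ _
  have hnb : ∀ u ∈ x ::ₘ ∑ p, first (arm p), u ≠ b ∧ u ∈ D := by
    intro u hu
    constructor
    · rintro rfl
      rcases Multiset.mem_cons.1 hu with hu | hu
      · exact hbx hu.symm
      · obtain ⟨⟨i, c⟩, -, hp⟩ := Multiset.mem_sum.1 hu
        have hnodup := h.nodup i.1 (Multiset.mem_of_mem_filter (Multiset.coe_mem (x := i)))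
        rw [hAB i] at hnodup
        have hm := mem_of_mem_first hp
        cases c
        · simp only [arm, Bool.false_eq_true, if_false] at hm
          rw [List.nodup_append'] at hnodup
          exact hnodup.2.2 (List.mem_reverse.2 hm) (by simp)
        · simp only [arm, if_true] at hm
          exact (List.nodup_cons.1 (List.nodup_append'.1 hnodup).2.1).1 hm
    · refine hD u ?_
      rcases Multiset.mem_cons.1 hu with rfl | hu
      · simp
      · rw [← hEeq]
        refine Multiset.mem_cons_of_mem (Multiset.mem_add.2 (Or.inl (Multiset.mem_add.2 (Or.inl ?_))))
        exact Multiset.mem_map_of_mem _ hu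
  obtain ⟨arm', harm, r, hr, r', hr', heq⟩ := exists_reversed_arms arm R Finset.univ x hnd (by
    intro u hu
    obtain ⟨hub, huD⟩ := hnb u hu
    rw [← hDeq] at huD
    rcases Multiset.mem_add.1 huD with hu | hu
    · right
      obtain ⟨p, -, hp⟩ := Multiset.mem_sum.1 hu
      refine ⟨p, Finset.mem_univ _, ?_⟩
      rw [farEnd, List.reverse_cons] at hp
      cases ha : arm p with
      -- An empty arm has far end `b`, whereas `u ≠ b`.
      | nil => simp [ha] at hp; exact absurd hp hub
      | cons c t => rwa [first_append_of_ne_nil (by simp [ha]), ha] at hp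
    · left
      obtain ⟨S, hS, huS⟩ := Multiset.mem_join.1 hu
      obtain ⟨r, hr, rfl⟩ := Multiset.mem_map.1 hS
      exact ⟨r, hr, huS⟩)
  have hbr : b ∉ r' := by
    have : b ∉ r := (Multiset.mem_filter.1 hr).2
    rcases hr' with rfl | rfl <;> simpa using this
  have hrM : r ∈ M := Multiset.mem_of_mem_filter hr
  have hr'nd : r'.Nodup := by
    have := h.nodup r hrM
    rcases hr' with rfl | rfl <;> simpa using this
  have hr'edges : pathEdges r' = pathEdges r := by
    rcases hr' with rfl | rfl <;> simp
  have hr'ends : pathEnds r' = pathEnds r := by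
    rcases hr' with rfl | rfl <;> simp
  have hRcons := Multiset.cons_erase hr
  have harmEdges : ∑ p, pathEdges (arm' p) = ∑ p, pathEdges (arm p) :=
    Finset.sum_congr rfl fun p _ => by rcases harm p with h | h <;> simp [h]
  have harmEnds : ∑ p, farEnd b (arm' p) + ∑ p, first (arm' p) =
      ∑ p, farEnd b (arm p) + ∑ p, first (arm p) := by
    rw [← Finset.sum_add_distrib, ← Finset.sum_add_distrib]
    refine Finset.sum_congr rfl fun p _ => ?_
    rcases harm p with h | h <;> rw [h]
    exact farEnd_add_first_reverse _ _
  have hperm : ∀ p, (arm' p).Perm (arm p) := fun p => by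
    rcases harm p with h | h <;> rw [h]
    exact List.reverse_perm _
  let Mb' : Multiset (List V) :=
    (Finset.univ : Finset Mb).val.map fun i => (arm' (i, false)).reverse ++ b :: arm' (i, true)
  -- The arms are glued back at `b` in the same pairs, and `b` is prefixed to the one path taken
  -- from `R`; the number of paths is unchanged.
  refine ⟨Mb' + (b :: r') ::ₘ R.erase r, _, ⟨?_, ?_, ?_, rfl⟩, ?_⟩
  · intro l hl
    rw [Multiset.mem_add, Multiset.mem_cons] at hl
    rcases hl with hl | rfl | hl
    · obtain ⟨i, -, rfl⟩ := Multiset.mem_map.1 hl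
      simp
    · simp
    · exact h.ne_nil l (Multiset.mem_of_mem_filter (Multiset.mem_of_mem_erase hl))
  · intro l hl
    rw [Multiset.mem_add, Multiset.mem_cons] at hl
    rcases hl with hl | rfl | hl
    · obtain ⟨i, -, rfl⟩ := Multiset.mem_map.1 hl
      have hnodup := h.nodup i.1 (Multiset.mem_of_mem_filter (Multiset.coe_mem (x := i)))
      rw [hAB i] at hnodup
      refine (List.Perm.nodup_iff ?_).2 hnodup
      refine List.Perm.append ?_ (List.Perm.cons _ (hperm (i, true)))
      exact ((List.reverse_perm _).trans (hperm (i, false))).trans (List.reverse_perm _).symm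
    · exact List.nodup_cons.2 ⟨hbr, hr'nd⟩
    · exact h.nodup l (Multiset.mem_of_mem_filter (Multiset.mem_of_mem_erase hl))
  · have h1 : (Mb'.map pathEdges).sum = (∑ p, first (arm' p)).map (fun c => s(b, c)) +
        ∑ p, pathEdges (arm p) := by
      rw [← harmEdges, ← hedges, Multiset.map_map]
      rfl
    have h2 := congrArg (Multiset.map fun c => s(b, c)) heq
    simp only [Multiset.map_add, Multiset.map_singleton] at h2
    have h3 : (R.map pathEdges).sum = pathEdges r + ((R.erase r).map pathEdges).sum := by
      conv_lhs => rw [← hRcons]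
      simp
    rw [Multiset.map_add, sum_add, h1, Multiset.map_cons, sum_cons, pathEdges_cons, hr'edges,
      ← Multiset.singleton_add, ← hEeq, h3]
    calc _ = ((∑ p, first (arm' p)).map (fun c => s(b, c)) + (first r').map (fun c => s(b, c))) +
          (∑ p, pathEdges (arm p) + pathEdges r + ((R.erase r).map pathEdges).sum) := by abel
      _ = _ := by rw [h2]; abel
  · have h1 : (Mb'.map pathEnds).sum = ∑ p, farEnd b (arm' p) := by
      rw [← hends, Multiset.map_map]
      rfl
    have h3 : (R.map pathEnds).sum = pathEnds r + ((R.erase r).map pathEnds).sum := by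
      conv_lhs => rw [← hRcons]
      simp
    have h4 : pathEnds (b :: r') = {b} + farEnd b r' := rfl
    have h5 : farEnd b r' + first r' = pathEnds r := by
      rw [← hr'ends, farEnd, List.reverse_cons, first_append_of_ne_nil, pathEnds, add_comm]
      have := h.ne_nil r hrM
      rcases hr' with rfl | rfl <;> simpa using this
    rw [Multiset.map_add, sum_add, h1, Multiset.map_cons, sum_cons, h4, ← hDeq, h3,
      ← Multiset.singleton_add, ← Multiset.singleton_add]
    -- Adding the first vertices of the arms to both sides makes the sum invariant under reversal of
    -- arms.
    refine add_right_cancel (b := ∑ p, first (arm p)) ?_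
    calc _ = ∑ p, farEnd b (arm' p) + (∑ p, first (arm p) + {x}) + {b} + farEnd b r' +
          ((R.erase r).map pathEnds).sum := by abel
      _ = (∑ p, farEnd b (arm' p) + ∑ p, first (arm' p)) + {b} + (farEnd b r' + first r') +
          ((R.erase r).map pathEnds).sum := by rw [← heq]; abel
      _ = _ := by rw [harmEnds, h5]; abel

/-! ### Parity of ends. -/

/-- In a path, the number of edges at a vertex has the parity of the number of times that the
vertex is an end. -/
theorem even_count_pathEnds_add [DecidableEq V] {l : List V} (hl : l.Nodup) (v : V) :
    Even (count v (pathEnds l) + countP (v ∈ ·) (pathEdges l)) := by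
  induction l with
  | nil => simp [pathEnds]
  | cons a l ih =>
    have ih := ih (List.nodup_cons.1 hl).2
    cases l with
    | nil =>
      simp only [pathEnds, List.reverse_singleton, first_cons, count_add, pathEdges_singleton,
        countP_zero, add_zero]
      exact ⟨_, rfl⟩
    | cons c l =>
      have hac : a ≠ c := by
        rintro rfl
        simp at hl
      have hlast : first (a :: c :: l).reverse = first (c :: l).reverse := by
        rw [List.reverse_cons]
        exact first_append_of_ne_nil (by simp) _
      have hends : ∀ (d : V) (t : List V), count v (first (d :: t)) = if v = d then 1 else 0 := by
        intro d t
        rw [first_cons, count_singleton]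
      have hedge : countP (v ∈ ·) ((first (c :: l)).map fun c' => s(a, c')) =
          if v = a ∨ v = c then 1 else 0 := by
        rw [first_cons, Multiset.map_singleton, ← Multiset.cons_zero, countP_cons, countP_zero,
          zero_add]
        simp only [Sym2.mem_iff]
      rw [pathEnds, hlast, pathEdges_cons, countP_add, count_add, hends, hedge]
      rw [pathEnds, count_add, hends] at ih
      by_cases h1 : v = a <;> by_cases h2 : v = c
      · exact absurd (h1.symm.trans h2) hac
      all_goals simp only [h1, h2, hac, hac.symm, if_true, if_false, or_self, or_true, true_or] at ih ⊢
      all_goals grind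

theorem IsSystem.even_count_add [DecidableEq V] {M : Multiset (List V)} {E : Multiset (Sym2 V)}
    {D : Multiset V} (h : IsSystem M E D) (v : V) : Even (count v D + countP (v ∈ ·) E) := by
  rw [← h.ends, ← h.edges]
  have := h.nodup
  clear h
  induction M using Multiset.induction_on with
  | empty => simp
  | cons l M ih =>
    rw [Multiset.map_cons, Multiset.map_cons, sum_cons, sum_cons, count_add, countP_add]
    have h1 := ih fun l' hl => this l' (by simp [hl])
    have h2 := even_count_pathEnds_add (this l (by simp)) v
    grind

/-! ### Path systems with prescribed ends. -/

/-- The edges of a finite graph, as a multiset. -/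
noncomputable def graphEdges [Finite V] (G : SimpleGraph V) : Multiset (Sym2 V) :=
  G.edgeSet.toFinite.toFinset.val

@[simp] theorem mem_graphEdges [Finite V] {G : SimpleGraph V} {e : Sym2 V} :
    e ∈ graphEdges G ↔ e ∈ G.edgeSet := by
  simp [graphEdges]

theorem nodup_graphEdges [Finite V] (G : SimpleGraph V) : (graphEdges G).Nodup :=
  Finset.nodup _

theorem add_graphEdges_deleteEdges [Finite V] {G : SimpleGraph V} {E : Multiset (Sym2 V)}
    (hE : E.Nodup) (h : ∀ e ∈ E, e ∈ G.edgeSet) :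
    E + graphEdges (G.deleteEdges {e | e ∈ E}) = graphEdges G := by
  classical
  refine ((Multiset.Nodup.ext ?_ (nodup_graphEdges G)).2 fun e => ?_)
  · refine (Multiset.Nodup.add_iff hE (nodup_graphEdges _)).2 ?_
    rw [Multiset.disjoint_left]
    intro e he he'
    simp [edgeSet_deleteEdges, he] at he'
  · simp only [Multiset.mem_add, mem_graphEdges, edgeSet_deleteEdges, Set.mem_sdiff,
      Set.mem_ofPred_eq]
    by_cases he : e ∈ E <;> simp [he, h]

theorem isSystem_trivial_paths (D : Multiset V) :
    IsSystem (D.map fun v => [v]) 0 (2 • D) where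
  ne_nil := by simp
  nodup := by simp
  edges := by simp
  ends := by
    simp only [Multiset.map_map, Function.comp_def, pathEnds, List.reverse_singleton, first_cons]
    rw [Multiset.sum_map_add, Multiset.sum_map_singleton, two_nsmul]

/-- A path system with prescribed ends exists as soon as the parities are right and every component
has at most one vertex that is not an end. -/
theorem exists_isSystem [Finite V] [DecidableEq V] (H : SimpleGraph V) (D : Multiset V)
    (hpar : ∀ v, Even (count v D + countP (v ∈ ·) (graphEdges H)))
    (hz : ∀ u v, H.Reachable u v → u ∉ D → v ∉ D → u = v) :
    ∃ M, IsSystem M (graphEdges H) D := by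
  induction hn : card (graphEdges H) generalizing H D with
  | zero =>
    rw [card_eq_zero] at hn
    simp only [hn, countP_zero, add_zero] at hpar ⊢
    -- Without edges all multiplicities in `D` are even, and one-vertex paths supply the ends two at
    -- a time.
    obtain ⟨D', rfl⟩ : ∃ D', D = 2 • D' := by
      refine Multiset.exists_smul_of_dvd_count D fun a _ => (hpar a).two_dvd
    exact ⟨_, isSystem_trivial_paths D'⟩
  | succ n ih =>
    -- The edge to delete starts at a non-end `x` if some non-end has a neighbour. Otherwise any
    -- edge serves. In both cases `x` is the only possible non-end of its component.
    obtain ⟨x, b, hxb, hbD, hx⟩ : ∃ x b, H.Adj x b ∧ b ∈ D ∧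
        ∀ u, H.Reachable x u → u ∉ D → u = x := by
      by_cases h0 : ∃ v w, H.Adj v w ∧ v ∉ D
      · obtain ⟨v, w, hvw, hv⟩ := h0
        refine ⟨v, w, hvw, ?_, fun u hu huD => (hz v u hu hv huD).symm⟩
        by_contra hw
        exact hvw.ne (hz v w hvw.reachable hv hw)
      · push Not at h0
        obtain ⟨e, he⟩ := Multiset.card_pos_iff_exists_mem.1 (by omega : 0 < card (graphEdges H))
        rw [mem_graphEdges] at he
        induction e with
        | _ x b =>
          have hxb : H.Adj x b := he
          refine ⟨x, b, hxb, h0 b x hxb.symm, fun u hu huD => ?_⟩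
          by_contra hne
          obtain ⟨p⟩ := hu.symm
          cases p with
          | nil => exact hne rfl
          | cons h _ => exact huD (h0 _ _ h)
    set H' := H.deleteEdges {e | e ∈ ({s(b, x)} : Multiset (Sym2 V))} with hH'
    have hle : H' ≤ H := deleteEdges_le _
    have hEq : s(b, x) ::ₘ graphEdges H' = graphEdges H := by
      rw [← Multiset.singleton_add]
      refine add_graphEdges_deleteEdges (nodup_singleton _) fun e he => ?_
      rw [Multiset.mem_singleton.1 he]
      exact hxb.symm
    -- Deleting the edge flips the parities at `x` and `b`, so one end moves from `b` to `x`;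
    -- `IsSystem.add_edge` moves it back. The only possible new non-end is `b`, and it shares its
    -- old component with no non-end other than `x`, which is now an end.
    obtain ⟨M, hM⟩ := ih H' (x ::ₘ D.erase b) (by
        intro v
        have h := hpar v
        rw [← hEq, ← Multiset.cons_erase hbD] at h
        simp only [count_cons, countP_cons, Sym2.mem_iff] at h ⊢
        have := hxb.ne
        by_cases h1 : v = x <;> by_cases h2 : v = b <;> grind) (by
        intro u v huv hu hv
        rw [Multiset.mem_cons, not_or] at hu hv
        have key : ∀ w, w ≠ x → w ∉ D.erase b → w ∉ D ∨ w = b := by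
          intro w _ hw
          by_cases hwb : w = b
          · exact Or.inr hwb
          · exact Or.inl fun h => hw ((Multiset.mem_erase_of_ne hwb).2 h)
        have huvH : H.Reachable u v := huv.mono hle
        rcases key u hu.1 hu.2 with h1 | rfl <;> rcases key v hv.1 hv.2 with h2 | rfl
        · exact hz u v huvH h1 h2
        · exact absurd (hx u (hxb.reachable.trans huvH.symm) h1) hu.1
        · exact absurd (hx v (hxb.reachable.trans huvH) h2) hv.1
        · rfl) (by
        have := congrArg card hEq
        rw [card_cons] at this
        omega)
    obtain ⟨M', D', hM', hD'⟩ := hM.add_edge (b := b) (x := x) (by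
        rw [hEq]
        exact nodup_graphEdges H) hxb.ne (by
        intro u hu
        rw [hEq, mem_graphEdges, mem_edgeSet] at hu
        rw [Multiset.mem_cons]
        by_cases hux : u = x
        · exact Or.inl hux
        · right
          rw [Multiset.mem_erase_of_ne hu.ne']
          by_contra huD
          exact hux (hx u (hxb.reachable.trans hu.reachable) huD))
    rw [Multiset.cons_swap, Multiset.cons_erase hbD, Multiset.cons_inj_right] at hD'
    rw [hEq, hD'] at hM'
    exact ⟨M', hM'⟩

theorem first_support {G : SimpleGraph V} {u v : V} (p : G.Walk u v) : first p.support = {u} := by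
  cases p <;> simp

theorem pathEdges_support {G : SimpleGraph V} {u v : V} (p : G.Walk u v) :
    pathEdges p.support = (p.edges : Multiset (Sym2 V)) := by
  induction p with
  | nil => simp
  | cons h p ih =>
    rw [Walk.support_cons, pathEdges_cons, ih, Walk.edges_cons, first_support]
    simp

theorem pathEnds_support {G : SimpleGraph V} {u v : V} (p : G.Walk u v) :
    pathEnds p.support = {u, v} := by
  rw [pathEnds, ← Walk.support_reverse, first_support, first_support]
  rfl

theorem isSystem_support {G : SimpleGraph V} {u v : V} {p : G.Walk u v} (hp : p.IsPath) :
    IsSystem {p.support} (p.edges : Multiset (Sym2 V)) {u, v} := by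
  rw [← pathEdges_support, ← pathEnds_support p]
  exact isSystem_singleton (Walk.support_ne_nil p) hp.support_nodup

/-! ### Splitting off paths between even vertices. -/

/-- Every graph decomposes into two path systems, each of which has each vertex at most once as an
end, such that the ends of the second are among those of the first. -/
theorem exists_two_isSystem [Finite V] (H : SimpleGraph V) :
    ∃ (Q J : Multiset (List V)) (E F : Multiset (Sym2 V)) (C D : Multiset V),
      IsSystem Q E C ∧ IsSystem J F D ∧ E + F = graphEdges H ∧ C.Nodup ∧ D.Nodup ∧ D ⊆ C := by
  classical
  -- `J` collects the removed paths and `H'` is what remains. All ends used so far have odd degree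
  -- in `H'`, so a new path between even vertices has new ends.
  suffices h : ∀ (n : ℕ) (H' : SimpleGraph V), card (graphEdges H') = n →
      ∀ (J : Multiset (List V)) (F : Multiset (Sym2 V)) (D : Multiset V), IsSystem J F D →
      graphEdges H' + F = graphEdges H → D.Nodup →
      (∀ v ∈ D, ¬ Even (countP (v ∈ ·) (graphEdges H'))) →
      ∃ (Q J : Multiset (List V)) (E F : Multiset (Sym2 V)) (C D : Multiset V),
      IsSystem Q E C ∧ IsSystem J F D ∧ E + F = graphEdges H ∧ C.Nodup ∧ D.Nodup ∧ D ⊆ C from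
    h _ H rfl 0 0 0 ⟨by simp, by simp, by simp, by simp⟩ (by simp) (by simp) (by simp)
  intro n
  induction n using Nat.strong_induction_on with
  | _ n ih =>
  intro H' hn J F D hJ hF hnd hodd
  by_cases hex : ∃ u v, H'.Reachable u v ∧ u ≠ v ∧ Even (countP (u ∈ ·) (graphEdges H')) ∧
      Even (countP (v ∈ ·) (graphEdges H'))
  · obtain ⟨u, v, huv, hne, hu, hv⟩ := hex
    obtain ⟨p, hp⟩ := huv.exists_isPath
    have hEq := add_graphEdges_deleteEdges (G := H') (E := (p.edges : Multiset (Sym2 V)))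
      (Multiset.coe_nodup.2 hp.isTrail.edges_nodup)
      (fun e he => p.edges_subset_edgeSet (Multiset.mem_coe.1 he))
    set H'' := H'.deleteEdges {e | e ∈ (p.edges : Multiset (Sym2 V))}
    have hcount : ∀ w, countP (w ∈ ·) (graphEdges H') =
        countP (w ∈ ·) (p.edges : Multiset (Sym2 V)) + countP (w ∈ ·) (graphEdges H'') := by
      intro w
      rw [← hEq, countP_add]
    have hpS := isSystem_support hp
    have hpar : ∀ w, Even (count w {u, v} + countP (w ∈ ·) (p.edges : Multiset (Sym2 V))) :=
      hpS.even_count_add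
    have huD : u ∉ D := fun h => hodd u h hu
    have hvD : v ∉ D := fun h => hodd v h hv
    refine ih (card (graphEdges H'')) ?_ H'' rfl _ _ _ (hpS.add hJ) ?_ ?_ ?_
    · have h1 := congrArg card hEq
      rw [card_add, coe_card, Walk.length_edges] at h1
      have : p.length ≠ 0 := fun h => hne (Walk.eq_of_length_eq_zero h)
      omega
    · rw [← hF, ← hEq]
      abel
    · rw [Multiset.insert_eq_cons, Multiset.cons_add, Multiset.singleton_add]
      simp [hne, huD, hvD, hnd]
    · intro w hw
      have h1 := hpar w
      have h2 := hcount w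
      rw [Multiset.insert_eq_cons, count_cons, count_singleton] at h1
      rw [Multiset.insert_eq_cons, Multiset.cons_add, Multiset.singleton_add] at hw
      simp only [Multiset.mem_cons] at hw
      rcases hw with rfl | rfl | hw
      · rw [if_neg hne, if_pos rfl] at h1
        grind
      · rw [if_pos rfl, if_neg hne.symm] at h1
        grind
      · have h3 : w ≠ u := by rintro rfl; exact huD hw
        have h4 : w ≠ v := by rintro rfl; exact hvD hw
        have h5 := hodd w hw
        rw [if_neg h3, if_neg h4] at h1
        grind
  · push Not at hex
    let := Fintype.ofFinite V
    -- No component now has two even vertices, so the odd vertices can be prescribed as ends, each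
    -- once.
    set C := (Finset.univ.filter fun v => ¬ Even (countP (v ∈ ·) (graphEdges H'))).val with hC
    have hCmem : ∀ v, v ∈ C ↔ ¬ Even (countP (v ∈ ·) (graphEdges H')) := by simp [hC]
    obtain ⟨Q, hQ⟩ := exists_isSystem H' C (by
      intro v
      rw [Multiset.count_eq_of_nodup (Finset.nodup _)]
      split_ifs with h
      · have := (hCmem v).1 h
        grind
      · rw [hCmem, not_not] at h
        simpa using h) (by
      intro u v huv hu hv
      rw [hCmem, not_not] at hu hv
      by_contra hne
      exact hex u v huv hne hu hv)
    exact ⟨Q, J, _, F, C, D, hQ, hJ, hF, Finset.nodup _, hnd, fun v hv => (hCmem v).2 (hodd v hv)⟩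

/-! ### Rooted paths and pairs from Hall's theorem. -/

theorem exists_cons_of_mem_pathEnds {l : List V} {u : V} (h : u ∈ pathEnds l) :
    ∃ t, pathEdges (u :: t) = pathEdges l ∧ (l.Nodup → (u :: t).Nodup) := by
  rcases Multiset.mem_add.1 h with h | h
  · obtain ⟨t, rfl⟩ := exists_cons_of_mem_first h
    exact ⟨t, rfl, id⟩
  · obtain ⟨t, ht⟩ := exists_cons_of_mem_first h
    refine ⟨t, ?_, fun hl => ?_⟩
    · rw [← ht, pathEdges_reverse]
    · rw [← ht]
      exact List.nodup_reverse.2 hl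

/-- Indexing by the coercion of `M` keeps repeated lists apart, which lets Hall's theorem treat the
paths as an indexed family. -/
theorem sum_coe_eq_sum_map [DecidableEq V] {β : Type*} [AddCommMonoid β] (M : Multiset V)
    (f : V → β) : ∑ i : M, f i = (M.map f).sum := by
  conv_rhs => rw [← Multiset.map_univ_coe M, Multiset.map_map]
  rfl

section

variable [DecidableEq V] {M : Multiset (List V)} {E : Multiset (Sym2 V)} {D : Multiset V}

theorem IsSystem.sum_pathEnds_le (h : IsSystem M E D) (X : Finset M) :
    ∑ i ∈ X, pathEnds i.1 ≤ D := by
  rw [← h.ends, ← sum_coe_eq_sum_map]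
  exact Finset.sum_le_sum_of_subset (Finset.subset_univ X)

/-- When no vertex is an end twice, the ends of different paths, and the two ends of each path, are
all distinct. -/
theorem IsSystem.two_mul_card_eq (h : IsSystem M E D) (hD : D.Nodup) (X : Finset M) :
    2 * X.card = (X.biUnion fun i => (pathEnds i.1).toFinset).card := by
  have h1 : (∑ i ∈ X, pathEnds i.1).toFinset = X.biUnion fun i => (pathEnds i.1).toFinset := by
    ext v
    simp [Multiset.mem_sum]
  rw [← h1, Multiset.toFinset_card_of_nodup (nodup_of_le (h.sum_pathEnds_le X) hD),
    Multiset.card_sum, Finset.sum_congr rfl fun i _ => card_pathEnds (h.ne_nil i.1 Multiset.coe_mem)]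
  simp [mul_comm]

theorem IsSystem.card_biUnion_le (h : IsSystem M E D) (X : Finset M) :
    (X.biUnion fun i => (pathEnds i.1).toFinset).card ≤ 2 * X.card := by
  rw [mul_comm]
  refine Finset.card_biUnion_le_card_mul _ _ _ fun i _ => ?_
  exact (Multiset.toFinset_card_le _).trans (card_pathEnds (h.ne_nil i.1 Multiset.coe_mem)).le

theorem IsSystem.eq_of_mem_pathEnds (h : IsSystem M E D) (hD : D.Nodup) {i j : M} {v : V}
    (hi : v ∈ pathEnds i.1) (hj : v ∈ pathEnds j.1) : i = j := by
  classical
  by_contra hij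
  have h1 := nodup_of_le (h.sum_pathEnds_le {i, j}) hD
  rw [Finset.sum_pair hij] at h1
  exact Multiset.disjoint_left.1 (Multiset.nodup_add.1 h1).2.2 hi hj

theorem IsSystem.mem_of_mem_pathEnds (h : IsSystem M E D) {i : M} {v : V}
    (hi : v ∈ pathEnds i.1) : v ∈ D := by
  have := h.sum_pathEnds_le {i}
  rw [Finset.sum_singleton] at this
  exact Multiset.mem_of_le this hi

theorem IsSystem.exists_mem_pathEnds (h : IsSystem M E D) {v : V} (hv : v ∈ D) :
    ∃ i : M, v ∈ pathEnds i.1 := by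
  rw [← h.ends, ← sum_coe_eq_sum_map, Multiset.mem_sum] at hv
  obtain ⟨i, -, hi⟩ := hv
  exact ⟨i, hi⟩

end

/-- Every graph decomposes into paths, one starting at each vertex. -/
theorem exists_rooted_paths [Fintype V] (H : SimpleGraph V) :
    ∃ A : V → List V, (∀ v, (v :: A v).Nodup) ∧ ∑ v, pathEdges (v :: A v) = graphEdges H := by
  classical
  obtain ⟨Q, J, E, F, C, D, hQ, hJ, hEF, hC, hD, -⟩ := exists_two_isSystem H
  let l : Q ⊕ J → List V := Sum.elim (fun i => i.1) (fun i => i.1)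
  have hl : ∀ i, (l i).Nodup := by
    rintro (i | i)
    · exact hQ.nodup _ Multiset.coe_mem
    · exact hJ.nodup _ Multiset.coe_mem
  -- Hall's condition: a subfamily with `q` paths of `Q` and `j` of `J` has at least `max (2q) (2j)
  -- ≥ q + j` ends. The representatives serve as roots.
  obtain ⟨f, hf, hfl⟩ := (Finset.all_card_le_biUnion_card_iff_exists_injective
    fun i => (pathEnds (l i)).toFinset).1 (by
      intro X
      have h1 : (X.toLeft.biUnion fun i => (pathEnds i.1).toFinset).card ≤
          (X.biUnion fun i => (pathEnds (l i)).toFinset).card := by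
        refine Finset.card_le_card fun v hv => ?_
        obtain ⟨i, hi, hv⟩ := Finset.mem_biUnion.1 hv
        exact Finset.mem_biUnion.2 ⟨Sum.inl i, Finset.mem_toLeft.1 hi, hv⟩
      have h2 : (X.toRight.biUnion fun i => (pathEnds i.1).toFinset).card ≤
          (X.biUnion fun i => (pathEnds (l i)).toFinset).card := by
        refine Finset.card_le_card fun v hv => ?_
        obtain ⟨i, hi, hv⟩ := Finset.mem_biUnion.1 hv
        exact Finset.mem_biUnion.2 ⟨Sum.inr i, Finset.mem_toRight.1 hi, hv⟩
      rw [← hQ.two_mul_card_eq hC] at h1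
      rw [← hJ.two_mul_card_eq hD] at h2
      have := Finset.card_toLeft_add_card_toRight (u := X)
      omega)
  have hex : ∀ i, ∃ t, pathEdges (f i :: t) = pathEdges (l i) ∧
      ((l i).Nodup → (f i :: t).Nodup) := fun i =>
    exists_cons_of_mem_pathEnds (Multiset.mem_toFinset.1 (hfl i))
  choose t ht htn using hex
  refine ⟨Function.extend f t fun _ => [], fun v => ?_, ?_⟩
  · by_cases hv : ∃ i, f i = v
    · obtain ⟨i, rfl⟩ := hv
      rw [hf.extend_apply]
      exact htn i (hl i)
    · rw [Function.extend_apply' _ _ _ hv]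
      simp
  · rw [← hEF, ← hQ.edges, ← hJ.edges, ← sum_coe_eq_sum_map, ← sum_coe_eq_sum_map]
    calc _ = ∑ i, pathEdges (l i) := by
          refine (Fintype.sum_of_injective f hf _ _ (fun v hv => ?_) fun i => ?_).symm
          · rw [Function.extend_apply' _ _ _ hv]
            simp
          · rw [hf.extend_apply, ht]
      _ = _ := Fintype.sum_sum_type _

/-- Every graph on `n` vertices decomposes into pairs of paths, both paths of a pair starting at the
same vertex and different pairs at different vertices, and further paths, such that there are at
most `n / 2` pairs and further paths. -/
theorem exists_rooted_pairs [Fintype V] (H : SimpleGraph V) :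
    ∃ (S : Finset V) (A B : V → List V) (F : Multiset (List V)),
      (∀ v, (v :: A v).Nodup) ∧ (∀ v, (v :: B v).Nodup) ∧ (∀ l ∈ F, l ≠ []) ∧
      (∀ l ∈ F, l.Nodup) ∧
      ∑ v ∈ S, (pathEdges (v :: A v) + pathEdges (v :: B v)) + (F.map pathEdges).sum =
        graphEdges H ∧
      2 * (S.card + card F) ≤ Fintype.card V := by
  classical
  obtain ⟨Q, J, E, F, C, D, hQ, hJ, hEF, hC, hD, hDC⟩ := exists_two_isSystem H
  -- Each path of `J` is matched to a path of `Q` sharing an end. For Hall's condition, the `2|X|`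
  -- ends of `X` are all ends of the paths in its neighbourhood `Y`, and these have at most `2|Y|`
  -- ends.
  obtain ⟨g, hg, hgt⟩ := (Finset.all_card_le_biUnion_card_iff_exists_injective
    fun j : J => (Finset.univ.filter fun q : Q => ∃ u ∈ pathEnds j.1, u ∈ pathEnds q.1)).1 (by
      intro X
      set Y := X.biUnion fun j : J =>
        (Finset.univ.filter fun q : Q => ∃ u ∈ pathEnds j.1, u ∈ pathEnds q.1) with hY
      have h1 := hJ.two_mul_card_eq hD X
      have h2 := hQ.card_biUnion_le Y
      have h3 : (X.biUnion fun i => (pathEnds i.1).toFinset).card ≤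
          (Y.biUnion fun i => (pathEnds i.1).toFinset).card := by
        refine Finset.card_le_card fun v hv => ?_
        obtain ⟨j, hj, hv⟩ := Finset.mem_biUnion.1 hv
        rw [Multiset.mem_toFinset] at hv
        obtain ⟨q, hq⟩ := hQ.exists_mem_pathEnds (hDC (hJ.mem_of_mem_pathEnds hv))
        refine Finset.mem_biUnion.2 ⟨q, ?_, Multiset.mem_toFinset.2 hq⟩
        exact Finset.mem_biUnion.2 ⟨j, hj, Finset.mem_filter.2 ⟨Finset.mem_univ _, v, hv, hq⟩⟩
      omega)
  have hu : ∀ j, ∃ u, u ∈ pathEnds j.1 ∧ u ∈ pathEnds (g j).1 := by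
    intro j
    obtain ⟨u, h1, h2⟩ := (Finset.mem_filter.1 (hgt j)).2
    exact ⟨u, h1, h2⟩
  choose u huJ huQ using hu
  have hui : Function.Injective u := by
    intro i j hij
    refine hJ.eq_of_mem_pathEnds hD (huJ i) ?_
    rw [hij]
    exact huJ j
  choose a ha han using fun j => exists_cons_of_mem_pathEnds (huJ j)
  choose b hb hbn using fun j => exists_cons_of_mem_pathEnds (huQ j)
  have hnod : ∀ t : J → List V, (∀ j, (u j :: t j).Nodup) → ∀ v,
      (v :: Function.extend u t (fun _ => []) v).Nodup := by
    intro t ht v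
    by_cases hv : ∃ i, u i = v
    · obtain ⟨i, rfl⟩ := hv
      rw [hui.extend_apply]
      exact ht i
    · rw [Function.extend_apply' _ _ _ hv]
      simp
  have hcompl : ∀ q ∈ (Finset.univ.image g)ᶜ.val.map (fun q : Q => q.1), q ∈ Q := by
    intro q hq
    obtain ⟨q, -, rfl⟩ := Multiset.mem_map.1 hq
    exact Multiset.coe_mem
  -- The roots are the shared ends, and the unmatched paths of `Q` are the further ones. The count
  -- is thus `|J| + (|Q| - |J|) = |Q|`, half the number of odd vertices left in the remainder.
  refine ⟨Finset.univ.image u, Function.extend u a fun _ => [], Function.extend u b fun _ => [],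
    (Finset.univ.image g)ᶜ.val.map (fun q : Q => q.1),
    hnod a fun j => han j (hJ.nodup _ Multiset.coe_mem),
    hnod b fun j => hbn j (hQ.nodup _ Multiset.coe_mem),
    fun l hl => hQ.ne_nil l (hcompl l hl), fun l hl => hQ.nodup l (hcompl l hl), ?_, ?_⟩
  · rw [Finset.sum_image hui.injOn, Multiset.map_map]
    simp only [hui.extend_apply, ha, hb]
    rw [Finset.sum_add_distrib, ← hEF, ← hQ.edges, ← hJ.edges,
      ← sum_coe_eq_sum_map Q, ← sum_coe_eq_sum_map J, ← Finset.sum_add_sum_compl (Finset.univ.image g),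
      Finset.sum_image hg.injOn]
    exact add_rotate _ _ _
  · rw [Finset.card_image_of_injective _ hui, Multiset.card_map, Finset.card_val,
      Finset.card_compl, Finset.card_image_of_injective _ hg]
    have h1 : Fintype.card J ≤ Fintype.card Q := Fintype.card_le_of_injective g hg
    have h2 := hQ.card_ends
    have h3 : card C ≤ Fintype.card V := by
      rw [← Multiset.toFinset_card_of_nodup hC]
      exact Finset.card_le_univ _
    rw [Finset.card_univ]
    simp only [Multiset.card_coe] at *
    omega

theorem mem_of_mem_pathEdges {l : List V} {e : Sym2 V} (he : e ∈ pathEdges l) {v : V}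
    (hv : v ∈ e) : v ∈ l := by
  induction l with
  | nil => simp at he
  | cons a l ih =>
    rw [pathEdges_cons, Multiset.mem_add, Multiset.mem_map] at he
    rcases he with ⟨c, hc, rfl⟩ | he
    · rcases Sym2.mem_iff.1 hv with rfl | rfl
      · exact List.mem_cons_self
      · exact List.mem_cons_of_mem _ (mem_of_mem_first hc)
    · exact List.mem_cons_of_mem _ (ih he)

theorem nodup_sum {ι α : Type*} {s : Finset ι} {f : ι → Multiset α} (h : ∀ i ∈ s, (f i).Nodup)
    (hd : ∀ i ∈ s, ∀ j ∈ s, i ≠ j → Disjoint (f i) (f j)) : (∑ i ∈ s, f i).Nodup := by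
  change (s.val.bind f).Nodup
  exact Multiset.nodup_bind.2 ⟨h, Multiset.Nodup.pairwise hd s.nodup⟩

/-! ### Path systems and path decompositions -/

theorem exists_isSystem_of_isPathDecomposition [Finite V] {G : SimpleGraph V}
    {P : Finset G.Subgraph} (hP : G.IsPathDecomposition P) :
    ∃ M D, IsSystem M (graphEdges G) D ∧ card M = P.card := by
  classical
  choose! u v p hp hpS using hP.isPath
  have hS : ∀ S (hS : S ∈ P) (e : Sym2 V), e ∈ (p S hS).edges ↔ e ∈ S.edgeSet := by
    intro S hS e
    conv_rhs => rw [← hpS S hS]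
    exact (Walk.mem_edges_toSubgraph _).symm
  refine ⟨P.attach.val.map fun S => (p S.1 S.2).support, _, ⟨?_, ?_, ?_, rfl⟩,
    by rw [Multiset.card_map, Finset.card_val, Finset.card_attach]⟩
  · intro l hl
    obtain ⟨S, -, rfl⟩ := Multiset.mem_map.1 hl
    exact Walk.support_ne_nil _
  · intro l hl
    obtain ⟨S, -, rfl⟩ := Multiset.mem_map.1 hl
    exact (hp S.1 S.2).support_nodup
  · rw [Multiset.map_map]
    simp only [Function.comp_def, pathEdges_support]
    change ∑ S ∈ P.attach, ((p S.1 S.2).edges : Multiset (Sym2 V)) = _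
    refine (Multiset.Nodup.ext (nodup_sum ?_ ?_) (nodup_graphEdges G)).2 fun e => ?_
    · exact fun S _ => Multiset.coe_nodup.2 (hp S.1 S.2).isTrail.edges_nodup
    · intro S _ T _ hST
      rw [Multiset.disjoint_left]
      intro e he he'
      rw [Multiset.mem_coe, hS] at he he'
      exact Set.disjoint_left.1
        (hP.edgeDisjoint S.1 S.2 T.1 T.2 fun h => hST (Subtype.ext h)) he he'
    · rw [Multiset.mem_sum, mem_graphEdges]
      constructor
      · rintro ⟨S, -, he⟩
        exact (p S.1 S.2).edges_subset_edgeSet (Multiset.mem_coe.1 he)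
      · intro he
        obtain ⟨S, hSP, heS⟩ := hP.cover e he
        exact ⟨⟨S, hSP⟩, Finset.mem_attach _ _, Multiset.mem_coe.2 ((hS S hSP e).2 heS)⟩

theorem exists_walk_support_eq {G : SimpleGraph V} {l : List V} (hl : l ≠ [])
    (h : ∀ e ∈ pathEdges l, e ∈ G.edgeSet) : ∃ (u v : V) (p : G.Walk u v), p.support = l := by
  induction l with
  | nil => exact absurd rfl hl
  | cons a l ih =>
    cases l with
    | nil => exact ⟨a, a, Walk.nil, rfl⟩
    | cons c l =>
      simp only [pathEdges_cons a, first_cons, Multiset.map_singleton, Multiset.singleton_add,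
        Multiset.mem_cons, forall_eq_or_imp, mem_edgeSet] at h
      obtain ⟨u, v, p, hp⟩ := ih (by simp) h.2
      obtain rfl : u = c := by
        have := first_support p
        rw [hp, first_cons] at this
        exact (Multiset.singleton_inj.1 this).symm
      exact ⟨a, v, Walk.cons h.1 p, by rw [Walk.support_cons, hp]⟩

/-- Distinct members share no edge because the edges of the graph are listed once. Repeated
one-vertex paths may collapse to one subgraph, which only lowers the count. -/
theorem IsSystem.pathNumber_le [Finite V] {G : SimpleGraph V} {M : Multiset (List V)}
    {D : Multiset V} (h : IsSystem M (graphEdges G) D) : G.pathNumber ≤ card M := by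
  classical
  have hsum : ∑ i : M, pathEdges i.1 = graphEdges G := by
    rw [← h.edges, sum_coe_eq_sum_map]
  have hle : ∀ X : Finset M, ∑ i ∈ X, pathEdges i.1 ≤ graphEdges G := by
    intro X
    rw [← hsum]
    exact Finset.sum_le_sum_of_subset (Finset.subset_univ X)
  have hwalk : ∀ i : M, ∃ (u v : V) (p : G.Walk u v), p.support = i.1 := by
    intro i
    refine exists_walk_support_eq (h.ne_nil _ Multiset.coe_mem) fun e he => ?_
    have := hle {i}
    rw [Finset.sum_singleton] at this
    exact mem_graphEdges.1 (Multiset.mem_of_le this he)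
  choose u v p hp using hwalk
  have hmem : ∀ i (e : Sym2 V), e ∈ (p i).toSubgraph.edgeSet ↔ e ∈ pathEdges i.1 := by
    intro i e
    rw [← hp i, pathEdges_support, Multiset.mem_coe, Walk.mem_edges_toSubgraph]
  have hdec : G.IsPathDecomposition (Finset.univ.image fun i => (p i).toSubgraph) := by
    refine ⟨?_, ?_, ?_⟩
    · intro S hS
      obtain ⟨i, -, rfl⟩ := Finset.mem_image.1 hS
      refine ⟨u i, v i, p i, Walk.IsPath.mk' ?_, rfl⟩
      rw [hp]
      exact h.nodup _ Multiset.coe_mem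
    · intro S hS T hT hST
      obtain ⟨i, -, rfl⟩ := Finset.mem_image.1 hS
      obtain ⟨j, -, rfl⟩ := Finset.mem_image.1 hT
      have hij : i ≠ j := fun hij => hST (by rw [hij])
      have h1 := nodup_of_le (hle {i, j}) (nodup_graphEdges G)
      rw [Finset.sum_pair hij] at h1
      rw [Set.disjoint_left]
      intro e he he'
      exact Multiset.disjoint_left.1 (Multiset.nodup_add.1 h1).2.2 ((hmem i e).1 he)
        ((hmem j e).1 he')
    · intro e he
      rw [← mem_graphEdges, ← hsum, Multiset.mem_sum] at he
      obtain ⟨i, -, he⟩ := he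
      exact ⟨_, Finset.mem_image_of_mem _ (Finset.mem_univ i), (hmem i e).2 he⟩
  have hcard : (Finset.univ.image fun i => (p i).toSubgraph).card ≤ card M := by
    refine Finset.card_image_le.trans ?_
    rw [Finset.card_univ, Multiset.card_coe]
  exact le_trans (Nat.sInf_le ⟨_, hdec, rfl⟩) hcard

/-! ### Minimal path systems -/

theorem countP_graphEdges [Fintype V] [DecidableEq V] (G : SimpleGraph V) [DecidableRel G.Adj]
    (v : V) : countP (v ∈ ·) (graphEdges G) = G.degree v := by
  rw [← card_incidenceFinset_eq_degree, countP_eq_card_filter, graphEdges,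
    ← Finset.filter_val, Finset.card_val]
  congr 1
  ext e
  simp [incidenceSet]

/-- If `p(G) = n_o(G) / 2`, then `G` has a path system in which every vertex of odd degree is an
end exactly once and the other vertices are no ends. -/
theorem exists_isSystem_odd [Fintype V] (G : SimpleGraph V) [DecidableRel G.Adj]
    (hp : (G.pathNumber : ℚ) = (G.oddVertexCount : ℚ) / 2) :
    ∃ M, IsSystem M (graphEdges G) (Finset.univ.filter fun v => Odd (G.degree v)).val := by
  classical
  obtain ⟨P, hP, hPcard⟩ := G.exists_isPathDecomposition_card_eq_pathNumber
  obtain ⟨M, D, hM, hMcard⟩ := exists_isSystem_of_isPathDecomposition hP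
  have h2 : 2 * G.pathNumber = G.oddVertexCount := by
    have : (2 * G.pathNumber : ℚ) = G.oddVertexCount := by rw [hp]; ring
    exact_mod_cast this
  -- By parity every odd vertex is an end at least once. The total number of ends is `2 p(G) =
  -- n_o(G)`, which leaves no room for others.
  have hle : (Finset.univ.filter fun v => Odd (G.degree v)).val ≤ D := by
    refine (Multiset.le_iff_subset (Finset.nodup _)).2 fun v hv => ?_
    have hv : Odd (G.degree v) := by simpa using hv
    have h3 := hM.even_count_add v
    rw [countP_graphEdges] at h3
    rw [← Multiset.count_pos]
    by_contra h0
    rw [Nat.pos_iff_ne_zero, not_not] at h0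
    rw [h0, zero_add] at h3
    exact Nat.not_even_iff_odd.2 hv h3
  refine ⟨M, ?_⟩
  rw [Multiset.eq_of_le_of_card_le hle]
  · exact hM
  · rw [hM.card_ends, hMcard, hPcard, h2]
    rfl

/-- The paths of a system can be cut at given inner vertices. -/
theorem IsSystem.exists_cut [DecidableEq V] {M : Multiset (List V)} {E : Multiset (Sym2 V)}
    {D : Multiset V} (h : IsSystem M E D) (hM : ∀ l ∈ M, (pathEnds l).Nodup) (Z : Finset V)
    (hZD : ∀ v ∈ Z, v ∉ D) (hZE : ∀ v ∈ Z, ∃ e ∈ E, v ∈ e) :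
    ∃ M', IsSystem M' E (D + (Z.val + Z.val)) ∧ (∀ l ∈ M', (pathEnds l).Nodup) ∧
      card M' = card M + Z.card := by
  induction Z using Finset.induction_on with
  | empty => exact ⟨M, by simpa using h, hM, by simp⟩
  | insert v Z hv ih =>
    obtain ⟨M', hM', hends, hcard⟩ := ih (fun u hu => hZD u (Finset.mem_insert_of_mem hu))
      fun u hu => hZE u (Finset.mem_insert_of_mem hu)
    obtain ⟨e, he, hve⟩ := hZE v (Finset.mem_insert_self _ _)
    have hvD := hZD v (Finset.mem_insert_self _ _)
    rw [← hM'.edges] at he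
    obtain ⟨s, hs, hes⟩ := Multiset.mem_join.1 he
    obtain ⟨l, hl, rfl⟩ := Multiset.mem_map.1 hs
    -- Since `v` is an inner vertex of its path, both pieces of the cut have distinct ends.
    have hlv : v ∉ pathEnds l := by
      intro hvl
      have : v ∈ D + (Z.val + Z.val) := by
        rw [← hM'.ends]
        exact Multiset.mem_join.2 ⟨_, Multiset.mem_map_of_mem _ hl, hvl⟩
      simp [hvD, hv] at this
    obtain ⟨A, B, rfl⟩ := exists_eq_reverse_append_cons (mem_of_mem_pathEdges hes hve)
    obtain ⟨M₀, rfl⟩ := Multiset.exists_cons_of_mem hl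
    have hnd := hM'.nodup _ hl
    have hperm : (A.reverse ++ v :: B).Perm (v :: (A ++ B)) :=
      List.perm_middle.trans ((List.Perm.append_right _ (List.reverse_perm _)).cons _)
    have hndAB := hperm.nodup_iff.1 hnd
    rw [pathEnds_through] at hlv
    have key : ∀ A : List V, v ∉ A → v ∉ farEnd v A → (pathEnds (v :: A)).Nodup := by
      intro A hA hvA
      rw [pathEnds, first_cons, Multiset.singleton_add, Multiset.nodup_cons]
      refine ⟨hvA, ?_⟩
      have := card_first (l := (v :: A).reverse) (by simp)
      obtain ⟨a, ha⟩ := Multiset.card_eq_one.1 this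
      rw [ha]
      exact Multiset.nodup_singleton a
    simp only [Multiset.mem_add, not_or] at hlv
    rw [List.nodup_cons, List.mem_append, not_or, List.nodup_append'] at hndAB
    have hpathEnds : ∀ A : List V, pathEnds (v :: A) = {v} + farEnd v A := fun A => rfl
    refine ⟨(v :: A) ::ₘ (v :: B) ::ₘ M₀, ⟨?_, ?_, ?_, ?_⟩, ?_, ?_⟩
    · simp only [Multiset.mem_cons, forall_eq_or_imp]
      exact ⟨by simp, by simp, fun l hl => hM'.ne_nil l (Multiset.mem_cons_of_mem hl)⟩
    · simp only [Multiset.mem_cons, forall_eq_or_imp]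
      exact ⟨List.nodup_cons.2 ⟨hndAB.1.1, hndAB.2.1⟩, List.nodup_cons.2 ⟨hndAB.1.2, hndAB.2.2.1⟩,
        fun l hl => hM'.nodup l (Multiset.mem_cons_of_mem hl)⟩
    · rw [← hM'.edges]
      simp only [Multiset.map_cons, Multiset.sum_cons, pathEdges_through, add_assoc]
    · have := hM'.ends
      simp only [Multiset.map_cons, Multiset.sum_cons, pathEnds_through, hpathEnds] at this ⊢
      rw [Finset.insert_val_of_notMem hv, ← Multiset.singleton_add]
      calc _ = {v} + {v} + (farEnd v A + farEnd v B + (M₀.map pathEnds).sum) := by abel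
        _ = _ := by rw [this]; abel
    · simp only [Multiset.mem_cons, forall_eq_or_imp]
      exact ⟨key A hndAB.1.1 hlv.1, key B hndAB.1.2 hlv.2,
        fun l hl => hends l (Multiset.mem_cons_of_mem hl)⟩
    · simp only [Multiset.card_cons, Finset.card_insert_of_notMem hv] at hcard ⊢
      omega

/-! ### Cartesian products -/

/-- Paths of a copy of `H` can be attached to the ends of a path of a copy of `G`. -/
theorem exists_joined_path {l : List V} (hnd : l.Nodup) {a z : V} (hends : pathEnds l = {a, z})
    (haz : a ≠ z) {w : W} {s t : List W} (hs : (w :: s).Nodup) (ht : (w :: t).Nodup) :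
    ∃ L : List (V × W), L ≠ [] ∧ L.Nodup ∧ pathEdges L =
      (pathEdges l).map (Sym2.map (·, w)) + ((pathEdges (w :: s)).map (Sym2.map (a, ·)) +
        (pathEdges (w :: t)).map (Sym2.map (z, ·))) := by
  wlog hfirst : first l = {a} generalizing a z s t with hswap
  · have : first l = {z} := by
      cases l with
      | nil => simp [pathEnds] at hends
      | cons c l =>
        have hc : c ∈ pathEnds (c :: l) := Multiset.mem_add.2 (Or.inl (by simp))
        rw [hends] at hc
        simp only [Multiset.insert_eq_cons, Multiset.mem_cons, Multiset.mem_singleton] at hc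
        rcases hc with rfl | rfl
        · exact absurd rfl hfirst
        · rfl
    obtain ⟨L, h1, h2, h3⟩ := hswap (hends.trans (Multiset.pair_comm a z)) haz.symm ht hs this
    exact ⟨L, h1, h2, by rw [h3, add_comm (Multiset.map _ (pathEdges (w :: t)))]⟩
  have hlast : first l.reverse = {z} := by
    rw [pathEnds, hfirst, Multiset.singleton_add, Multiset.insert_eq_cons,
      Multiset.cons_inj_right] at hends
    exact hends
  obtain ⟨m, hm⟩ : ∃ m, l = m ++ [z] := by
    obtain ⟨m, hm⟩ := exists_cons_of_mem_first (hlast ▸ Multiset.mem_singleton_self z)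
    exact ⟨m.reverse, by rw [← List.reverse_reverse l, hm, List.reverse_cons]⟩
  obtain ⟨m', hm'⟩ : ∃ m', m = a :: m' := by
    cases m with
    | nil =>
      rw [hm] at hfirst
      simp only [List.nil_append, first_cons] at hfirst
      exact absurd (Multiset.singleton_inj.1 hfirst).symm haz
    | cons c m =>
      rw [hm] at hfirst
      simp only [List.cons_append, first_cons] at hfirst
      rw [Multiset.singleton_inj.1 hfirst]
      exact ⟨m, rfl⟩
  subst hm'
  subst hm
  -- The three pieces lie in the copy of `H` over `a`, the copy of `G` over `w` and the copy of `H`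
  -- over `z`. As `a ≠ z`, they meet only at `(a, w)` and `(z, w)`.
  refine ⟨(s.map (a, ·)).reverse ++ (a, w) :: (m'.map (·, w) ++ (z, w) :: t.map (z, ·)),
    by simp, ?_, ?_⟩
  · have h1 : ((s.map (a, ·)).reverse ++ (a, w) :: (m'.map (·, w) ++ (z, w) :: t.map (z, ·))) =
        (s.map (a, ·)).reverse ++ (((a :: m') ++ [z]).map (·, w) ++ t.map (z, ·)) := by simp
    rw [h1, List.nodup_append', List.nodup_append', List.nodup_reverse]
    rw [List.nodup_cons] at hs ht
    refine ⟨hs.2.map (Prod.mk_right_injective a), ⟨hnd.map (Prod.mk_left_injective w),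
      ht.2.map (Prod.mk_right_injective z), ?_⟩, ?_⟩
    · rintro ⟨x, y⟩ hx hy
      simp only [List.mem_map, Prod.mk.injEq] at hx hy
      obtain ⟨x', -, -, rfl⟩ := hx
      obtain ⟨y', hy', -, rfl⟩ := hy
      exact ht.1 hy'
    · rintro ⟨x, y⟩ hx hy
      simp only [List.mem_reverse, List.mem_append, List.mem_map, Prod.mk.injEq] at hx hy
      obtain ⟨y', hy', rfl, rfl⟩ := hx
      rcases hy with ⟨x', -, -, rfl⟩ | ⟨x', -, rfl, -⟩
      · exact hs.1 hy'
      · exact haz rfl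
  · have h1 : (a, w) :: (m'.map (·, w) ++ (z, w) :: t.map (z, ·)) =
        ((a :: m').map (·, w)) ++ (z, w) :: t.map (z, ·) := by simp
    rw [pathEdges_through, h1, pathEdges_append_cons]
    have h2 : (a :: m').map (·, w) ++ [(z, w)] = ((a :: m') ++ [z]).map (·, w) := by simp
    have h3 : (a, w) :: s.map (a, ·) = (w :: s).map (a, ·) := rfl
    have h4 : (z, w) :: t.map (z, ·) = (w :: t).map (z, ·) := rfl
    rw [h2, h3, h4, pathEdges_map, pathEdges_map, pathEdges_map]
    abel

/-- Paths of copies of `H` can be attached to all the ends of a path system of a copy of `G`. -/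
theorem IsSystem.exists_join {M : Multiset (List V)} {E : Multiset (Sym2 V)} {D : Multiset V}
    (h : IsSystem M E D) (hM : ∀ l ∈ M, (pathEnds l).Nodup) (w : W) (T : Multiset (V × List W))
    (hTD : T.map Prod.fst = D) (hT : ∀ p ∈ T, (w :: p.2).Nodup) :
    ∃ N : Multiset (List (V × W)), (∀ L ∈ N, L ≠ []) ∧ (∀ L ∈ N, L.Nodup) ∧
      (N.map pathEdges).sum = E.map (Sym2.map (·, w)) +
        (T.map fun p => (pathEdges (w :: p.2)).map (Sym2.map (p.1, ·))).sum ∧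
      card N = card M := by
  classical
  obtain ⟨hne, hnd, rfl, hends⟩ := h
  induction M using Multiset.induction_on generalizing D T with
  | empty =>
    obtain rfl : T = 0 := by
      rw [← Multiset.map_eq_zero (f := Prod.fst), hTD, ← hends]
      simp
    exact ⟨0, by simp⟩
  | cons l M ih =>
    simp only [Multiset.mem_cons, forall_eq_or_imp] at hM hne hnd
    obtain ⟨a, z, haz⟩ := Multiset.card_eq_two.1 (card_pathEnds hne.1)
    rw [Multiset.map_cons, Multiset.sum_cons, haz, Multiset.insert_eq_cons, Multiset.cons_add,
      Multiset.singleton_add, ← hTD] at hends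
    -- The tails assigned to the two ends of `l` are taken out of `T`; a vertex occurring twice in
    -- `D` has two entries there.
    obtain ⟨⟨a', s⟩, hs, rfl, hTs⟩ := (Multiset.map_eq_cons _ _ _ _).2 hends.symm
    obtain ⟨⟨z', t⟩, ht, rfl, hTt⟩ := (Multiset.map_eq_cons _ _ _ _).2 hTs
    obtain ⟨T', rfl⟩ := Multiset.exists_cons_of_mem hs
    rw [Multiset.erase_cons_head] at ht hTt
    obtain ⟨T'', rfl⟩ := Multiset.exists_cons_of_mem ht
    rw [Multiset.erase_cons_head] at hTt
    simp only [Multiset.mem_cons, forall_eq_or_imp] at hT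
    obtain ⟨N, hN1, hN2, hN3, hN4⟩ := ih hM.2 T'' hTt hT.2.2 hne.2 hnd.2 rfl
    have haz' : a' ≠ z' := by
      have := hM.1
      rw [haz] at this
      simpa using this
    obtain ⟨L, hL1, hL2, hL3⟩ := exists_joined_path hnd.1 haz haz' hT.1 hT.2.1
    refine ⟨L ::ₘ N, by simpa using ⟨hL1, hN1⟩, by simpa using ⟨hL2, hN2⟩, ?_, by simp [hN4]⟩
    simp only [Multiset.map_cons, Multiset.sum_cons, Multiset.map_add, hL3, hN3]
    abel

theorem graphEdges_boxProd [Fintype V] [Fintype W] (G : SimpleGraph V) (H : SimpleGraph W) :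
    graphEdges (G.boxProd H) = ∑ w, (graphEdges G).map (Sym2.map (·, w)) +
      ∑ v, (graphEdges H).map (Sym2.map (v, ·)) := by
  classical
  refine ((Multiset.Nodup.ext (nodup_graphEdges _) (Multiset.nodup_add.2 ⟨?_, ?_, ?_⟩)).2 ?_)
  · refine nodup_sum (fun w _ => (nodup_graphEdges G).map
      (Sym2.map.injective (Prod.mk_left_injective w))) fun w _ w' _ hne => ?_
    rw [Multiset.disjoint_left]
    intro e he he'
    obtain ⟨e, -, rfl⟩ := Multiset.mem_map.1 he
    obtain ⟨e', -, he'⟩ := Multiset.mem_map.1 he'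
    induction e with | _ a b => induction e' with | _ c d => simp at he'; grind
  · refine nodup_sum (fun w _ => (nodup_graphEdges H).map
      (Sym2.map.injective (Prod.mk_right_injective w))) fun w _ w' _ hne => ?_
    rw [Multiset.disjoint_left]
    intro e he he'
    obtain ⟨e, -, rfl⟩ := Multiset.mem_map.1 he
    obtain ⟨e', -, he'⟩ := Multiset.mem_map.1 he'
    induction e with | _ a b => induction e' with | _ c d => simp at he'; grind
  · rw [Multiset.disjoint_left]
    intro e he he'
    obtain ⟨w, -, he⟩ := Multiset.mem_sum.1 he
    obtain ⟨v, -, he'⟩ := Multiset.mem_sum.1 he'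
    obtain ⟨e, hG, rfl⟩ := Multiset.mem_map.1 he
    obtain ⟨e', -, he'⟩ := Multiset.mem_map.1 he'
    induction e with
    | _ a b =>
      induction e' with
      | _ c d =>
        have := (mem_graphEdges.1 hG : G.Adj a b).ne
        simp at he'
        grind
  · intro e
    induction e with
    | _ x y =>
      obtain ⟨a, c⟩ := x
      obtain ⟨b, d⟩ := y
      simp only [mem_graphEdges, mem_edgeSet, boxProd_adj, Multiset.mem_add, Multiset.mem_sum,
        Multiset.mem_map, Finset.mem_univ, true_and]
      constructor
      · rintro (⟨h, rfl⟩ | ⟨h, rfl⟩)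
        · exact Or.inl ⟨_, s(a, b), h, rfl⟩
        · exact Or.inr ⟨_, s(c, d), h, rfl⟩
      · rintro (⟨w, e, he, heq⟩ | ⟨v, e, he, heq⟩)
        · induction e with
          | _ p q =>
            rw [mem_edgeSet] at he
            have := he.symm
            simp at heq
            grind
        · induction e with
          | _ p q =>
            rw [mem_edgeSet] at he
            have := he.symm
            simp at heq
            grind

/-- Each copy of `G` carries the `H`-paths rooted at its level, and only the families `F` over the
even vertices remain as separate paths. -/
theorem two_mul_pathNumber_boxProd_le [Fintype V] [Fintype W] (G : SimpleGraph V)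
    (H : SimpleGraph W) [DecidableRel G.Adj] (hG : G.Connected) (hm : 2 ≤ Fintype.card V)
    (hp : (G.pathNumber : ℚ) = (G.oddVertexCount : ℚ) / 2) :
    2 * (G.boxProd H).pathNumber ≤ Fintype.card V * Fintype.card W := by
  classical
  obtain ⟨M, hM⟩ := exists_isSystem_odd G hp
  set O := Finset.univ.filter fun v => Odd (G.degree v) with hO
  set Z := Finset.univ.filter fun v => ¬ Odd (G.degree v) with hZ
  have hOZ : O.card + Z.card = Fintype.card V := by
    rw [hO, hZ, Finset.card_filter_add_card_filter_not, Finset.card_univ]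
  have hMcard : O.card = 2 * card M := hM.card_ends
  have hMnd : ∀ l ∈ M, (pathEnds l).Nodup := by
    intro l hl
    refine nodup_of_le ?_ (Finset.nodup O)
    rw [← hM.ends]
    exact Multiset.single_le_sum (fun _ _ => Multiset.zero_le _) _ (Multiset.mem_map_of_mem _ hl)
  obtain ⟨M', hM', hMnd', hMcard'⟩ := hM.exists_cut hMnd Z
    (by
      intro v hv hvO
      rw [Finset.mem_val] at hvO
      exact (Finset.mem_filter.1 hv).2 (Finset.mem_filter.1 hvO).2)
    (by
      intro v _
      -- Connectedness and `m ≥ 2` exclude isolated vertices, so every even vertex lies on a path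
      -- that can be cut there.
      have : Nontrivial V := Fintype.one_lt_card_iff_nontrivial.1 hm
      obtain ⟨u, hu⟩ := hG.preconnected.exists_adj_of_nontrivial v
      exact ⟨s(v, u), mem_graphEdges.2 hu, Sym2.mem_mk_left _ _⟩)
  obtain ⟨A, hA, hAsum⟩ := exists_rooted_paths H
  obtain ⟨S, B, C, F, hB, hC, hFne, hFnd, hBsum, hScard⟩ := exists_rooted_pairs H
  let R : V → Multiset (Sym2 W) →+ Multiset (Sym2 (V × W)) := fun v =>
    Multiset.mapAddMonoidHom (Sym2.map (Prod.mk v))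
  have hjoin : ∀ w, ∃ N : Multiset (List (V × W)), (∀ L ∈ N, L ≠ []) ∧ (∀ L ∈ N, L.Nodup) ∧
      (N.map pathEdges).sum = (graphEdges G).map (Sym2.map (·, w)) +
        (∑ v ∈ O, R v (pathEdges (w :: A w)) +
          if w ∈ S then ∑ v ∈ Z, R v (pathEdges (w :: B w) + pathEdges (w :: C w)) else 0) ∧
      card N = card M + if w ∈ S then Z.card else 0 := by
    intro w
    by_cases hw : w ∈ S
    · obtain ⟨N, h1, h2, h3, h4⟩ := hM'.exists_join hMnd' w
        (O.val.map (fun v => (v, A w)) + (Z.val.map (fun v => (v, B w)) +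
          Z.val.map (fun v => (v, C w))))
        (by simp) (by
          intro p hp
          simp only [Multiset.mem_add, Multiset.mem_map] at hp
          obtain ⟨v, -, rfl⟩ | ⟨v, -, rfl⟩ | ⟨v, -, rfl⟩ := hp
          exacts [hA w, hB w, hC w])
      refine ⟨N, h1, h2, ?_, by rw [h4, hMcard', if_pos hw]⟩
      rw [h3, if_pos hw]
      simp only [_root_.map_add, Finset.sum_add_distrib, Multiset.map_add, Multiset.sum_add,
        Multiset.map_map]
      rfl
    · obtain ⟨N, h1, h2, h3, h4⟩ := hM.exists_join hMnd w (O.val.map (fun v => (v, A w)))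
        (by simp) (by
          intro p hp
          obtain ⟨v, -, rfl⟩ := Multiset.mem_map.1 hp
          exact hA w)
      refine ⟨N, h1, h2, ?_, by rw [h4, if_neg hw, add_zero]⟩
      rw [h3, if_neg hw, add_zero, Multiset.map_map]
      rfl
  choose N hN1 hN2 hN3 hN4 using hjoin
  let φ : Multiset (List (V × W)) →+ Multiset (Sym2 (V × W)) :=
    Multiset.sumAddMonoidHom.comp (Multiset.mapAddMonoidHom pathEdges)
  have hFv : ∀ v, φ (F.map (List.map (Prod.mk v))) = R v (F.map pathEdges).sum := by
    intro v
    rw [map_multiset_sum]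
    simp only [φ, R, AddMonoidHom.comp_apply, Multiset.coe_sumAddMonoidHom,
      Multiset.coe_mapAddMonoidHom, Multiset.map_map, Function.comp_def, pathEdges_map]
  obtain ⟨D, hsys⟩ : ∃ D, IsSystem (∑ w, N w + ∑ v ∈ Z, F.map (List.map (Prod.mk v)))
      (graphEdges (G.boxProd H)) D := by
    refine ⟨_, ?_, ?_, ?_, rfl⟩
    · intro L hL
      rw [Multiset.mem_add, Multiset.mem_sum, Multiset.mem_sum] at hL
      obtain ⟨w, -, hL⟩ | ⟨v, -, hL⟩ := hL
      · exact hN1 w L hL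
      · obtain ⟨l, hl, rfl⟩ := Multiset.mem_map.1 hL
        simpa using hFne l hl
    · intro L hL
      rw [Multiset.mem_add, Multiset.mem_sum, Multiset.mem_sum] at hL
      obtain ⟨w, -, hL⟩ | ⟨v, -, hL⟩ := hL
      · exact hN2 w L hL
      · obtain ⟨l, hl, rfl⟩ := Multiset.mem_map.1 hL
        exact (hFnd l hl).map (Prod.mk_right_injective v)
    · change φ _ = _
      rw [_root_.map_add, map_sum, map_sum, graphEdges_boxProd]
      have h1 : ∀ w, φ (N w) = ((N w).map pathEdges).sum := fun _ => rfl
      -- The edges of the copies of `H` are regrouped by the level `w` at which their paths are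
      -- rooted.
      have h2 : ∑ v ∈ O, R v (graphEdges H) = ∑ w, ∑ v ∈ O, R v (pathEdges (w :: A w)) := by
        rw [Finset.sum_comm]
        simp only [← hAsum, map_sum]
      have h3 : ∑ v ∈ Z, R v (graphEdges H) =
          ∑ w ∈ S, ∑ v ∈ Z, R v (pathEdges (w :: B w) + pathEdges (w :: C w)) +
            ∑ v ∈ Z, R v (F.map pathEdges).sum := by
        rw [Finset.sum_comm, ← Finset.sum_add_distrib]
        simp only [← hBsum, map_sum, _root_.map_add]
      have h4 : ∑ v, (graphEdges H).map (Sym2.map (v, ·)) =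
          ∑ v ∈ O, R v (graphEdges H) + ∑ v ∈ Z, R v (graphEdges H) :=
        (Finset.sum_filter_add_sum_filter_not _ _ _).symm
      rw [h4, h2, h3]
      simp only [h1, hN3, hFv, Finset.sum_add_distrib, Finset.sum_ite_mem, Finset.univ_inter]
      simp only [add_assoc]
  have hle := hsys.pathNumber_le
  have hcard : card (∑ w, N w + ∑ v ∈ Z, F.map (List.map (Prod.mk v))) =
      Fintype.card W * card M + Z.card * (S.card + card F) := by
    simp only [Multiset.card_add, Multiset.card_sum, hN4, Multiset.card_map, Finset.sum_const,
      Finset.sum_add_distrib, Finset.sum_ite_mem, Finset.univ_inter, Finset.card_univ, smul_eq_mul]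
    ring
  rw [hcard] at hle
  calc 2 * (G.boxProd H).pathNumber
      ≤ 2 * (Fintype.card W * card M + Z.card * (S.card + card F)) := Nat.mul_le_mul_left 2 hle
    _ = Fintype.card W * O.card + Z.card * (2 * (S.card + card F)) := by rw [hMcard]; ring
    _ ≤ Fintype.card W * O.card + Z.card * Fintype.card W := by gcongr
    _ = Fintype.card V * Fintype.card W := by rw [← hOZ]; ring

end SimpleGraph.PathSystem

theorem theorem4p2 {V W : Type*} [Fintype V] [Fintype W]
    (G : SimpleGraph V) (H : SimpleGraph W) [DecidableRel G.Adj]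
    (hG : G.Connected) (hm : 2 ≤ Fintype.card V)
    (hp : (G.pathNumber : ℚ) = (G.oddVertexCount : ℚ) / 2)
    (hH : H.Connected) :
    ((G.boxProd H).pathNumber : ℚ) ≤ (Fintype.card V : ℚ) * (Fintype.card W : ℚ) / 2 ∧
      ((G.boxProd H).Connected ∧
        (G.boxProd H).pathNumber ≤ ⌈(Fintype.card (V × W) : ℚ) / 2⌉₊) := by
  have h : ((G.boxProd H).pathNumber : ℚ) ≤
      (Fintype.card V : ℚ) * (Fintype.card W : ℚ) / 2 := by
    have h2 := SimpleGraph.PathSystem.two_mul_pathNumber_boxProd_le G H hG hm hp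
    rw [le_div_iff₀ two_pos, mul_comm]
    exact_mod_cast h2
  refine ⟨h, hG.boxProd hH, ?_⟩
  have h3 : ((G.boxProd H).pathNumber : ℚ) ≤ (Fintype.card (V × W) : ℚ) / 2 := by
    rw [Fintype.card_prod, Nat.cast_mul]
    exact h
  exact_mod_cast h3.trans (Nat.le_ceil _)
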